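/- Let $n\ge 1$ and let $\mathcal K_n$ be the set of convex bodies in $\mathbb R^n$ (compact convex sets with nonempty interior), equipped with the Hausdorff metric. An affine invariant point is a continuous map $p:\mathcal K_n\to\mathbb R^n$ such that $p(T(K))=T(p(K))$ for every $K\in\mathcal K_n$ and every nonsingular affine map $T:\mathbb R^n\to\mathbb R^n$; let $\mathfrak P_n$ be the set of all affine invariant points. For $K\in\mathcal K_n$ put $$\mathfrak P_n(K)=\{p(K): p\in\mathfrak P_n\},\qquad \mathfrak F_n(K)=\{x\in\mathbb R^n: Tx=x \text{ for all affine maps } T:\mathbb R^n\to\mathbb R^n \text{ with } T(K)=K\}.$$ Let $K\in\mathcal K_n$ be such that the affine hull of $\mathfrak P_n(K)$ is $(n-1)$-dimensional. Then $$\mathfrak P_n(K)=\mathfrak F_n(K).$$ Moreover, $\mathfrak P_n(K)$ is an affine hyperplane, and there is an affine reflection $S$ about this hyperplane, i.e. an affine map for which there is a direction $\xi\in\mathbb R^n$ not parallel to $\mathfrak P_n(K)$ with $S(h+t\xi)=h-t\xi$ for all $h\in\mathfrak P_n(K)$ and $t\in\mathbb R$, such that the affine maps $T$ with $T(K)=K$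 are exactly the identity and $S$. In particular $S(K)=K$. -/

import Mathlib

/-- Euclidean space `ℝⁿ`. -/
abbrev Euc (n : ℕ) : Type := EuclideanSpace ℝ (Fin n)

/-- The convex bodies in `ℝⁿ`: compact convex sets with nonempty interior. As a subtype of Mathlib's
`ConvexBody` (nonempty compact convex sets) it carries the Hausdorff metric. -/
abbrev SolidBody (n : ℕ) : Type :=
  {K : ConvexBody (Euc n) // (interior (K : Set (Euc n))).Nonempty}

/-- The image `T(K)` of a convex body under a nonsingular affine map. -/
def SolidBody.map {n : ℕ} (T : Euc n ≃ᵃ[ℝ] Euc n) (K : SolidBody n) : SolidBody n :=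
  ⟨{ carrier := T '' (K.1 : Set (Euc n))
     convex' := K.1.convex.affine_image T.toAffineMap
     isCompact' := K.1.isCompact.image T.toAffineMap.continuous_of_finiteDimensional
     nonempty' := K.1.nonempty.image T },
   (K.2.image T).mono
    ((AffineEquiv.toContinuousAffineEquiv T).toHomeomorph.image_interior
      (K.1 : Set (Euc n))).subset⟩

/-- `p` is an affine invariant point: it is continuous for the Hausdorff metric, and
`p(T(K)) = T(p(K))` for every nonsingular affine map `T`. -/
def IsAffineInvariantPoint {n : ℕ} (p : SolidBody n → Euc n) : Prop :=
  Continuous p ∧ ∀ (T : Euc n ≃ᵃ[ℝ] Euc n) (K : SolidBody n), p (K.map T) = T (p K)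

/-- `𝔓ₙ(K) = {p(K) : p an affine invariant point}`. -/
def affineInvariantPoints {n : ℕ} (K : SolidBody n) : Set (Euc n) :=
  {x | ∃ p : SolidBody n → Euc n, IsAffineInvariantPoint p ∧ p K = x}

/-- The affine maps `T` with `T(K) = K`. -/
def affineSymmetries {n : ℕ} (K : SolidBody n) : Set (Euc n →ᵃ[ℝ] Euc n) :=
  {T | T '' (K.1 : Set (Euc n)) = (K.1 : Set (Euc n))}

/-- `𝔉ₙ(K)`: the points fixed by every affine map `T` with `T(K) = K`. -/
def affineFixedPoints {n : ℕ} (K : SolidBody n) : Set (Euc n) :=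
  {x | ∀ T ∈ affineSymmetries K, T x = x}

/-- `S` is an affine reflection about the (affine) hyperplane `H`: for some direction `ξ` not
parallel to `H` one has `S(h + tξ) = h - tξ` for all `h ∈ H` and `t ∈ ℝ`. -/
def IsAffineReflection {n : ℕ} (S : Euc n →ᵃ[ℝ] Euc n) (H : AffineSubspace ℝ (Euc n)) : Prop :=
  (H : Set (Euc n)).Nonempty ∧ Module.finrank ℝ H.direction + 1 = n ∧
    ∃ ξ : Euc n, ξ ∉ H.direction ∧ ∀ h ∈ H, ∀ t : ℝ, S (h + t • ξ) = h - t • ξ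

/-! A symmetry of `K` preserves volume, hence is nonsingular, and so fixes every `p K`; thus `𝔓(K) ⊆
𝔉(K)`. Conversely, `𝔓(K)` is an affine subspace, hence closed, so it suffices to approximate a point
`x` fixed by all symmetries (`exists_isAffineInvariantPoint_near`). An affine map is encoded by the
tuple `y` of images of an affine basis `b`. Averaging over all tuples of points of `L` the image of
`x` under the map encoded by `y`, with an invariant weight favouring maps that nearly carry `K` onto
`L`, gives an affine invariant point. At `L = K` the weight sits on maps close to symmetries, which
hardly move `x`.

If `𝔓(K)` is a hyperplane, every symmetry fixes it pointwise, so its linear part is `v ↦ v + φ v •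
η` with determinant `1 + φ η = ±1` (`exists_eq_add_smul`). The value `1` would give a shear,
impossible on a bounded body unless `η = 0`; the value `-1` gives a reflection. A nontrivial
symmetry exists, as otherwise every point would be fixed. The composite of two reflections in the
same hyperplane has determinant `1`, so it is the identity and the two coincide. -/

open MeasureTheory Topology Filter

/-! ### Continuity in `L` of volumes and averages over powers of `L`. -/

namespace SolidBody

variable {n : ℕ}

theorem exists_dist_lt {K L : SolidBody n} {r : ℝ} (h : dist K L < r) {x : Euc n}
    (hx : x ∈ (K.1 : Set (Euc n))) : ∃ y ∈ (L.1 : Set (Euc n)), dist x y < r :=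
  Metric.exists_dist_lt_of_hausdorffDist_lt hx
    (by rw [ConvexBody.hausdorffDist_coe]; exact h) ConvexBody.hausdorffEDist_ne_top

/-- Points near a point outside `L` lie outside all convex bodies near `L`. -/
theorem eventually_notMem {L : SolidBody n} {x : Euc n} (hx : x ∉ (L.1 : Set (Euc n))) :
    ∀ᶠ q : SolidBody n × Euc n in 𝓝 (L, x), q.2 ∉ (q.1.1 : Set (Euc n)) := by
  obtain ⟨r, hr, hb⟩ := Metric.isOpen_iff.1 L.1.isCompact.isClosed.isOpen_compl x hx
  filter_upwards [Metric.ball_mem_nhds (L, x) (half_pos hr)] with q hq hmem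
  rw [Metric.mem_ball, Prod.dist_eq, max_lt_iff] at hq
  obtain ⟨z, hz, hz'⟩ := exists_dist_lt hq.1 hmem
  refine hb (?_ : z ∈ Metric.ball x r) hz
  rw [Metric.mem_ball]
  calc dist z x ≤ dist q.2 z + dist q.2 x := dist_triangle_left _ _ _
    _ < r := by linarith [hq.2]

/-- Points near an interior point of `L` lie in all convex bodies near `L`. -/
theorem eventually_mem {L : SolidBody n} {x : Euc n} (hx : x ∈ interior (L.1 : Set (Euc n))) :
    ∀ᶠ q : SolidBody n × Euc n in 𝓝 (L, x), q.2 ∈ (q.1.1 : Set (Euc n)) := by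
  obtain ⟨r, hr, hb⟩ := Metric.isOpen_iff.1 isOpen_interior x hx
  have hr2 := half_pos hr
  filter_upwards [Metric.ball_mem_nhds (L, x) hr2] with q hq
  rw [Metric.mem_ball, Prod.dist_eq, max_lt_iff] at hq
  by_contra hmem
  -- Let `v` be the point of the nearby body closest to `q.2`. Moving `q.2` by `r / 2` away from `v`
  -- stays inside `L`, yet ends more than `r / 2` from the nearby body, contradicting the Hausdorff
  -- bound.
  obtain ⟨v, hv, hmin⟩ := exists_norm_eq_iInf_of_complete_convex q.1.1.nonempty
    q.1.1.isCompact.isClosed.isComplete q.1.1.convex q.2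
  rw [norm_eq_iInf_iff_real_inner_le_zero q.1.1.convex hv] at hmin
  have hne : q.2 - v ≠ 0 := fun h => hmem (by rwa [sub_eq_zero.1 h])
  have hpos : 0 < ‖q.2 - v‖ := norm_pos_iff.2 hne
  set e : Euc n := ‖q.2 - v‖⁻¹ • (q.2 - v) with he
  have he1 : ‖e‖ = 1 := by
    rw [he, norm_smul, norm_inv, norm_norm, inv_mul_cancel₀ hpos.ne']
  have hmem' : q.2 + (r / 2) • e ∈ (L.1 : Set (Euc n)) := by
    refine interior_subset (hb ?_)
    rw [Metric.mem_ball, dist_eq_norm]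
    calc ‖q.2 + (r / 2) • e - x‖ = ‖(q.2 - x) + (r / 2) • e‖ := by congr 1; abel
      _ ≤ ‖q.2 - x‖ + ‖(r / 2) • e‖ := norm_add_le _ _
      _ < r := by
        rw [norm_smul, he1, Real.norm_of_nonneg hr2.le, ← dist_eq_norm]
        linarith [hq.2]
  obtain ⟨w, hw, hdist⟩ := exists_dist_lt (by rw [dist_comm]; exact hq.1) hmem'
  have h1 : inner ℝ e (w - v) ≤ 0 := by
    rw [he, real_inner_smul_left]
    exact mul_nonpos_of_nonneg_of_nonpos (inv_nonneg.2 hpos.le) (hmin w hw)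
  have h2 : inner ℝ e (q.2 - v) = ‖q.2 - v‖ := by
    rw [he, real_inner_smul_left, real_inner_self_eq_norm_sq]
    field_simp
  have h3 : inner ℝ e (q.2 + (r / 2) • e - w) ≤ ‖q.2 + (r / 2) • e - w‖ := by
    simpa [he1] using real_inner_le_norm e (q.2 + (r / 2) • e - w)
  have h4 : q.2 + (r / 2) • e - w = (q.2 - v) + (r / 2) • e - (w - v) := by abel
  rw [← dist_eq_norm, h4, inner_sub_right, inner_add_right, real_inner_smul_right, h2,
    real_inner_self_eq_norm_sq, he1] at h3
  linarith

theorem volume_pos (L : SolidBody n) : 0 < volume.real (L.1 : Set (Euc n)) :=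
  ENNReal.toReal_pos ((isOpen_interior.measure_pos volume L.2).trans_le
    (measure_mono interior_subset)).ne' L.1.isCompact.measure_lt_top.ne

/-- The tuples of points of `L`. -/
def power (ι : Type*) (L : SolidBody n) : Set (ι → Euc n) :=
  Set.univ.pi fun _ => (L.1 : Set (Euc n))

theorem isCompact_power {ι : Type*} (L : SolidBody n) : IsCompact (L.power ι) :=
  isCompact_univ_pi fun _ => L.1.isCompact

section Average

variable {ι : Type*} [Fintype ι]

theorem measurableSet_power (L : SolidBody n) : MeasurableSet (L.power ι) :=
  L.isCompact_power.isClosed.measurableSet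

theorem interior_power (L : SolidBody n) :
    interior (L.power ι) = Set.univ.pi fun _ => interior (L.1 : Set (Euc n)) :=
  interior_pi_set Set.finite_univ

theorem interior_power_nonempty (L : SolidBody n) : (interior (L.power ι)).Nonempty := by
  rw [interior_power]
  exact Set.univ_pi_nonempty_iff.2 fun _ => L.2

theorem volume_power_pos (L : SolidBody n) : 0 < volume.real (L.power ι) :=
  ENNReal.toReal_pos ((isOpen_interior.measure_pos volume L.interior_power_nonempty).trans_le
    (measure_mono interior_subset)).ne' L.isCompact_power.measure_lt_top.ne

/-- The frontier of a convex set is null, and off it membership is stable under small changes of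
`L`. This gives the pointwise convergence of indicators needed for dominated convergence. -/
theorem ae_eventually_mem_power_iff (L : SolidBody n) :
    ∀ᵐ y : ι → Euc n, ∀ᶠ L' in 𝓝 L, (y ∈ L'.power ι ↔ y ∈ L.power ι) := by
  have hconv : Convex ℝ (L.power ι) := convex_pi fun _ _ => L.1.convex
  filter_upwards [measure_eq_zero_iff_ae_notMem.1 (hconv.addHaar_frontier volume)] with y hy
  by_cases h : y ∈ L.power ι
  · have hint : y ∈ interior (L.power ι) := by
      by_contra h'
      exact hy ⟨subset_closure h, h'⟩
    rw [interior_power] at hint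
    have : ∀ᶠ L' in 𝓝 L, ∀ i, y i ∈ (L'.1 : Set (Euc n)) := eventually_all.2 fun i =>
      (Continuous.prodMk_left (y i)).continuousAt.eventually
        (eventually_mem (hint i trivial))
    filter_upwards [this] with L' hL'
    simp only [h, iff_true]
    exact fun i _ => hL' i
  · obtain ⟨i, hi⟩ : ∃ i, y i ∉ (L.1 : Set (Euc n)) := by
      by_contra! h'
      exact h fun i _ => h' i
    filter_upwards [(Continuous.prodMk_left (y i)).continuousAt.eventually
      (eventually_notMem hi)] with L' hL'
    simp only [h, iff_false]
    exact fun h' => hL' (h' i trivial)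

theorem exists_eventually_power_subset (L : SolidBody n) :
    ∃ R : ℝ, ∀ᶠ L' in 𝓝 L, L'.power ι ⊆ Metric.closedBall 0 R := by
  obtain ⟨R, hR⟩ := L.1.isCompact.isBounded.exists_norm_le
  refine ⟨R + 1, ?_⟩
  filter_upwards [Metric.ball_mem_nhds L one_pos] with L' hL' y hy
  have hR0 : 0 ≤ R := by
    obtain ⟨x, hx⟩ := L.1.nonempty
    exact (norm_nonneg x).trans (hR x hx)
  rw [mem_closedBall_zero_iff, pi_norm_le_iff_of_nonneg (by linarith)]
  intro i
  obtain ⟨z, hz, hd⟩ := exists_dist_lt hL' (hy i trivial)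
  rw [dist_eq_norm] at hd
  calc ‖y i‖ ≤ ‖z‖ + ‖y i - z‖ := norm_le_norm_add_norm_sub' _ _
    _ ≤ R + 1 := add_le_add (hR z hz) hd.le

variable {F : Type*} [NormedAddCommGroup F] [NormedSpace ℝ F]

theorem continuous_setIntegral_power {f : SolidBody n → (ι → Euc n) → F}
    (hf : Continuous (Function.uncurry f)) :
    Continuous fun L => ∫ y in L.power ι, f L y := by
  rw [continuous_iff_continuousAt]
  intro L
  obtain ⟨R, hR⟩ := L.exists_eventually_power_subset (ι := ι)
  have hfc (L' : SolidBody n) : Continuous (f L') := hf.comp (Continuous.prodMk_right L')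
  obtain ⟨C, hC⟩ := ((isCompact_closedBall (0 : ι → Euc n) R).image (hfc L)).isBounded.exists_norm_le
  have hbound : ∀ᶠ L' in 𝓝 L, ∀ y ∈ Metric.closedBall (0 : ι → Euc n) R, ‖f L' y‖ < C + 1 := by
    refine (isCompact_closedBall (0 : ι → Euc n) R).eventually_forall_of_forall_eventually
      fun y hy => ?_
    refine (hf.norm.continuousAt (x := (L, y))).eventually_lt_const ?_
    exact (hC _ ⟨y, hy, rfl⟩).trans_lt (lt_add_one C)
  simp_rw [ContinuousAt, ← integral_indicator (measurableSet_power _)]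
  refine tendsto_integral_filter_of_dominated_convergence
    ((Metric.closedBall 0 R).indicator fun _ => C + 1) ?_ ?_ ?_ ?_
  · exact .of_forall fun L' =>
      ((hfc L').aestronglyMeasurable.indicator L'.measurableSet_power)
  · filter_upwards [hR, hbound] with L' h1 h2
    refine .of_forall fun y => ?_
    by_cases hy : y ∈ L'.power ι
    · rw [Set.indicator_of_mem hy, Set.indicator_of_mem (h1 hy)]
      exact (h2 y (h1 hy)).le
    · rw [Set.indicator_of_notMem hy, norm_zero]
      refine Set.indicator_nonneg (fun z hz => ?_) y
      exact (norm_nonneg _).trans (h2 z hz).le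
  · exact (integrable_indicator_iff measurableSet_closedBall).2
      (integrableOn_const (isCompact_closedBall _ _).measure_lt_top.ne)
  · filter_upwards [L.ae_eventually_mem_power_iff (ι := ι)] with y hy
    have hlim : Tendsto (fun L' => (L.power ι).indicator (f L') y) (𝓝 L)
        (𝓝 ((L.power ι).indicator (f L) y)) := by
      by_cases h : y ∈ L.power ι
      · simp only [Set.indicator_of_mem h]
        exact (hf.comp (Continuous.prodMk_left y)).continuousAt
      · simp only [Set.indicator_of_notMem h]
        exact tendsto_const_nhds
    refine hlim.congr' ?_
    filter_upwards [hy] with L' h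
    by_cases h' : y ∈ L.power ι <;> simp [Set.indicator, h, h']

theorem continuous_volume_power : Continuous fun L : SolidBody n => volume.real (L.power ι) := by
  have := continuous_setIntegral_power (n := n) (ι := ι) (F := ℝ) (f := fun _ _ => 1)
    continuous_const
  simpa using this

theorem continuous_volume : Continuous fun L : SolidBody n => volume.real (L.1 : Set (Euc n)) := by
  have h := continuous_volume_power (n := n) (ι := Unit)
  refine h.congr fun L => ?_
  have := (volume_preserving_funUnique Unit (Euc n)).measureReal_preimage
    (s := (L.1 : Set (Euc n))) L.1.isCompact.isClosed.measurableSet.nullMeasurableSet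
  rw [← this]
  congr 1
  ext y
  exact ⟨fun h => h () trivial, fun h _ _ => h⟩

theorem continuous_setAverage_power {f : SolidBody n → (ι → Euc n) → F}
    (hf : Continuous (Function.uncurry f)) :
    Continuous fun L => ⨍ y in L.power ι, f L y := by
  simp_rw [setAverage_eq]
  exact (continuous_volume_power.inv₀ fun L => L.volume_power_pos.ne').smul
    (continuous_setIntegral_power hf)

end Average

end SolidBody

/-! ### Affine equivariance of averages; the centroid. -/

namespace SolidBody

variable {n : ℕ}

theorem map_eq_self {T : Euc n ≃ᵃ[ℝ] Euc n} {L : SolidBody n}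
    (h : T '' (L.1 : Set (Euc n)) = (L.1 : Set (Euc n))) : L.map T = L :=
  Subtype.ext (ConvexBody.ext h)

theorem apply_mem_map {T : Euc n ≃ᵃ[ℝ] Euc n} {L : SolidBody n} {x : Euc n} :
    T x ∈ ((L.map T).1 : Set (Euc n)) ↔ x ∈ (L.1 : Set (Euc n)) :=
  T.injective.mem_set_image

/-- The measure of the image of a set under an affine map. -/
theorem measure_affine_image (T : Euc n →ᵃ[ℝ] Euc n) (s : Set (Euc n)) :
    volume.real (T '' s) = |LinearMap.det T.linear| * volume.real s := by
  have : T '' s = (fun x => x + T 0) '' (T.linear '' s) := by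
    rw [Set.image_image]
    exact Set.image_congr fun x _ => congrFun T.decomp x
  rw [measureReal_def, this, Set.image_add_right, measure_preimage_add_right,
    Measure.addHaar_image_linearMap, ENNReal.toReal_mul, ENNReal.toReal_ofReal (abs_nonneg _)]
  rfl

theorem affine_preimage_null {T : Euc n →ᵃ[ℝ] Euc n} (hT : LinearMap.det T.linear ≠ 0)
    {s : Set (Euc n)} (hs : volume s = 0) : volume (T ⁻¹' s) = 0 := by
  have : T ⁻¹' s = T.linear ⁻¹' ((fun x => x + T 0) ⁻¹' s) := by
    rw [← Set.preimage_comp]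
    congr 1
    exact T.decomp
  rw [this, Measure.addHaar_preimage_linearMap _ hT, measure_preimage_add_right, hs, mul_zero]

section Average

variable {ι : Type*} [Fintype ι]

theorem exists_map_volume_pi (T : Euc n ≃ᵃ[ℝ] Euc n) :
    ∃ c : ENNReal, c ≠ 0 ∧ c ≠ ⊤ ∧
      Measure.map (fun (y : ι → Euc n) i => T (y i)) volume = c • volume := by
  have hdet := (LinearEquiv.isUnit_det'
    (LinearEquiv.piCongrRight fun _ : ι => T.linear)).ne_zero
  have hcomp : (fun (y : ι → Euc n) i => T (y i)) = (fun y => y + fun _ => T 0) ∘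
      ((LinearEquiv.piCongrRight fun _ : ι => T.linear : (ι → Euc n) →ₗ[ℝ] (ι → Euc n))) := by
    funext y i
    exact congrFun T.toAffineMap.decomp (y i)
  refine ⟨ENNReal.ofReal |(LinearMap.det
    (LinearEquiv.piCongrRight fun _ : ι => T.linear : (ι → Euc n) →ₗ[ℝ] (ι → Euc n)))⁻¹|,
    ?_, ENNReal.ofReal_ne_top, ?_⟩
  · rw [ne_eq, ENNReal.ofReal_eq_zero, not_le]
    exact abs_pos.2 (inv_ne_zero hdet)
  · rw [hcomp, ← Measure.map_map (measurable_add_const _)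
      (LinearMap.continuous_of_finiteDimensional _).measurable,
      Measure.map_linearMap_addHaar_eq_smul_addHaar _ hdet, Measure.map_smul,
      map_add_right_eq_self]

variable {F : Type*} [NormedAddCommGroup F] [NormedSpace ℝ F]

/-- The constant Jacobian of the diagonal action of `T` cancels between the integral and the volume.
-/
theorem setAverage_power_map (T : Euc n ≃ᵃ[ℝ] Euc n) (L : SolidBody n) (g : (ι → Euc n) → F) :
    ⨍ y in (L.map T).power ι, g y = ⨍ y in L.power ι, g (fun i => T (y i)) := by
  obtain ⟨c, hc0, hc, hmap⟩ := exists_map_volume_pi (ι := ι) T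
  have hemb : MeasurableEmbedding (fun (y : ι → Euc n) i => T (y i)) :=
    (Homeomorph.piCongrRight fun _ : ι =>
      (AffineEquiv.toContinuousAffineEquiv T).toHomeomorph).measurableEmbedding
  have hpre : (fun (y : ι → Euc n) i => T (y i)) ⁻¹' (L.map T).power ι = L.power ι := by
    ext y
    exact forall₂_congr fun i _ => apply_mem_map
  have hint := hemb.setIntegral_map (μ := volume) g ((L.map T).power ι)
  have hvol := hemb.map_apply volume ((L.map T).power ι)
  rw [hpre, hmap] at hint hvol
  rw [Measure.restrict_smul, integral_smul_measure] at hint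
  rw [Measure.smul_apply, smul_eq_mul] at hvol
  have hc' : c.toReal ≠ 0 := ENNReal.toReal_ne_zero.2 ⟨hc0, hc⟩
  rw [setAverage_eq, setAverage_eq, ← hint, measureReal_def, measureReal_def, ← hvol,
    ENNReal.toReal_mul, smul_smul, mul_inv, mul_comm c.toReal⁻¹, mul_assoc,
    inv_mul_cancel₀ hc', mul_one]

theorem setAverage_power_apply (T : Euc n →ᵃ[ℝ] Euc n) (L : SolidBody n)
    {g : (ι → Euc n) → Euc n} (hg : Continuous g) :
    ⨍ y in L.power ι, T (g y) = T (⨍ y in L.power ι, g y) := by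
  have hi : IntegrableOn g (L.power ι) := hg.continuousOn.integrableOn_compact L.isCompact_power
  have hc : Integrable (fun _ => T 0) (volume.restrict (L.power ι)) :=
    integrableOn_const L.isCompact_power.measure_lt_top.ne
  have hv := L.volume_power_pos (ι := ι)
  have h1 : ∀ x, T x = LinearMap.toContinuousLinearMap T.linear x + T 0 :=
    fun x => congrFun T.decomp x
  have h2 : (fun y => T (g y)) = fun y => LinearMap.toContinuousLinearMap T.linear (g y) + T 0 :=
    funext fun y => h1 _
  rw [h1 (⨍ y in L.power ι, g y), h2, setAverage_eq, setAverage_eq, integral_add (ContinuousLinearMap.integrable_comp _ hi) hc,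
    ContinuousLinearMap.integral_comp_comm _ hi, setIntegral_const, smul_add, smul_smul,
    inv_mul_cancel₀ hv.ne', one_smul, map_smul]

theorem isAffineInvariantPoint_setAverage {f : SolidBody n → (ι → Euc n) → Euc n}
    (hf : Continuous (Function.uncurry f))
    (hT : ∀ (T : Euc n ≃ᵃ[ℝ] Euc n) L y, f (L.map T) (fun i => T (y i)) = T (f L y)) :
    IsAffineInvariantPoint fun L => ⨍ y in L.power ι, f L y := by
  refine ⟨continuous_setAverage_power hf, fun T L => ?_⟩
  beta_reduce
  rw [setAverage_power_map]
  simp_rw [hT]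
  exact setAverage_power_apply T.toAffineMap L (hf.comp (Continuous.prodMk_right L))

end Average

/-- The centroid. -/
noncomputable def centroid (L : SolidBody n) : Euc n := ⨍ y in L.power Unit, y ()

theorem isAffineInvariantPoint_centroid : IsAffineInvariantPoint (centroid (n := n)) :=
  isAffineInvariantPoint_setAverage (f := fun _ y => y ())
    ((continuous_apply ()).comp continuous_snd) fun _ _ _ => rfl

end SolidBody

/-! ### Affine maps encoded by the images of an affine basis. -/

section FrameMap

variable {n : ℕ} {ι : Type*} [Fintype ι] (b : AffineBasis ι ℝ (Euc n))

/-- The affine map taking the affine basis `b` to `y`. -/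
noncomputable def frameMap (y : ι → Euc n) : Euc n →ᵃ[ℝ] Euc n where
  toFun z := ∑ i, b.coord i z • y i
  linear := ∑ i, (b.coord i).linear.smulRight (y i)
  map_vadd' p v := by
    simp_rw [AffineMap.map_vadd, vadd_eq_add, add_smul, Finset.sum_add_distrib,
      LinearMap.sum_apply, LinearMap.smulRight_apply]

theorem frameMap_apply (y : ι → Euc n) (z : Euc n) :
    frameMap b y z = ∑ i, b.coord i z • y i := rfl

theorem frameMap_basis : frameMap b b = AffineMap.id ℝ (Euc n) := by
  ext1 z
  exact b.linear_combination_coord_eq_self z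

/-- Barycentric coordinates sum to `1`, so `T` commutes with the combination. This is the source of
all equivariance in the frame variable. -/
theorem frameMap_comp (T : Euc n →ᵃ[ℝ] Euc n) (y : ι → Euc n) :
    frameMap b (fun i => T (y i)) = T.comp (frameMap b y) := by
  have h1 : ∀ x, T x = T.linear x + T 0 := fun x => congrFun T.decomp x
  ext1 z
  have h2 : ∑ i, b.coord i z • T (y i) = ∑ i, b.coord i z • (T.linear (y i) + T 0) :=
    Finset.sum_congr rfl fun i _ => by rw [h1 (y i)]
  rw [AffineMap.comp_apply, frameMap_apply, h1, frameMap_apply, map_sum, h2]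
  simp_rw [smul_add, Finset.sum_add_distrib, map_smul, ← Finset.sum_smul,
    b.sum_coord_apply_eq_one, one_smul]

theorem continuous_frameMap (z : Euc n) : Continuous fun y => frameMap b y z := by
  simp_rw [frameMap_apply]
  fun_prop

theorem continuous_det_frameMap :
    Continuous fun y => LinearMap.det (frameMap b y).linear := by
  have h : Continuous fun y => LinearMap.toContinuousLinearMap (frameMap b y).linear := by
    have : IsLinearMap ℝ fun y : ι → Euc n =>
        LinearMap.toContinuousLinearMap (frameMap b y).linear := by
      constructor
      · intro y y'
        ext1 v
        simp [frameMap, Finset.sum_add_distrib]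
      · intro c y
        ext1 v
        simp [frameMap, Finset.smul_sum, smul_comm c]
    exact (this.mk' _).continuous_of_finiteDimensional
  exact ContinuousLinearMap.continuous_det.comp h

end FrameMap

/-! ### How well an encoded affine map carries `K` onto `L`. -/

namespace SolidBody

variable {n : ℕ} {ι : Type*} [Fintype ι]

/-- The fraction of `K` that the affine map with frame `y` takes into `L`. -/
noncomputable def overlap (b : AffineBasis ι ℝ (Euc n)) (K L : SolidBody n) (y : ι → Euc n) : ℝ :=
  volume.real ((K.1 : Set (Euc n)) ∩ frameMap b y ⁻¹' (L.1 : Set (Euc n))) /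
    volume.real (K.1 : Set (Euc n))

/-- The volume of the image of `K` under the affine map with frame `y`, relative to that of `L`. -/
noncomputable def volumeRatio (b : AffineBasis ι ℝ (Euc n)) (K L : SolidBody n)
    (y : ι → Euc n) : ℝ :=
  |LinearMap.det (frameMap b y).linear| * volume.real (K.1 : Set (Euc n)) /
    volume.real (L.1 : Set (Euc n))

/-- A number in `[0, 1]`, equal to `1` only if the affine map with frame `y` takes `K` to `L`. -/
noncomputable def fit (b : AffineBasis ι ℝ (Euc n)) (K L : SolidBody n) (y : ι → Euc n) : ℝ :=
  overlap b K L y * min (volumeRatio b K L y) 1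

variable (b : AffineBasis ι ℝ (Euc n)) (K : SolidBody n)

theorem overlap_nonneg (L : SolidBody n) (y : ι → Euc n) : 0 ≤ overlap b K L y :=
  div_nonneg measureReal_nonneg measureReal_nonneg

theorem overlap_le_one (L : SolidBody n) (y : ι → Euc n) : overlap b K L y ≤ 1 :=
  div_le_one_of_le₀ (measureReal_mono Set.inter_subset_left K.1.isCompact.measure_lt_top.ne)
    measureReal_nonneg

theorem volumeRatio_nonneg (L : SolidBody n) (y : ι → Euc n) : 0 ≤ volumeRatio b K L y :=
  div_nonneg (mul_nonneg (abs_nonneg _) measureReal_nonneg) measureReal_nonneg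

theorem fit_nonneg (L : SolidBody n) (y : ι → Euc n) : 0 ≤ fit b K L y :=
  mul_nonneg (overlap_nonneg b K L y) (le_min (volumeRatio_nonneg b K L y) zero_le_one)

theorem fit_le_one (L : SolidBody n) (y : ι → Euc n) : fit b K L y ≤ 1 :=
  mul_le_one₀ (overlap_le_one b K L y) (le_min (volumeRatio_nonneg b K L y) zero_le_one)
    (min_le_right _ _)

theorem fit_le_volumeRatio (L : SolidBody n) (y : ι → Euc n) :
    fit b K L y ≤ volumeRatio b K L y :=
  (mul_le_of_le_one_left (le_min (volumeRatio_nonneg b K L y) zero_le_one)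
    (overlap_le_one b K L y)).trans (min_le_left _ _)

theorem fit_basis : fit b K K b = 1 := by
  have h := K.volume_pos.ne'
  simp [fit, overlap, volumeRatio, frameMap_basis, h]

theorem overlap_map (L : SolidBody n) (T : Euc n ≃ᵃ[ℝ] Euc n) (y : ι → Euc n) :
    overlap b K (L.map T) (fun i => T (y i)) = overlap b K L y := by
  have h : frameMap b (fun i => T (y i)) ⁻¹' ((L.map T).1 : Set (Euc n)) =
      frameMap b y ⁻¹' (L.1 : Set (Euc n)) := by
    ext z
    have := congrArg (· z) (frameMap_comp b T.toAffineMap y)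
    simp only [AffineMap.comp_apply] at this
    rw [Set.mem_preimage, Set.mem_preimage, ← apply_mem_map (T := T) (x := frameMap b y z)]
    exact iff_of_eq (congrArg (· ∈ ((L.map T).1 : Set (Euc n))) this)
  rw [overlap, h, overlap]

theorem volumeRatio_map (L : SolidBody n) (T : Euc n ≃ᵃ[ℝ] Euc n) (y : ι → Euc n) :
    volumeRatio b K (L.map T) (fun i => T (y i)) = volumeRatio b K L y := by
  have h1 : LinearMap.det (frameMap b (fun i => T (y i))).linear =
      LinearMap.det T.toAffineMap.linear * LinearMap.det (frameMap b y).linear := by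
    rw [← LinearMap.det_comp]
    exact congrArg (fun A : Euc n →ᵃ[ℝ] Euc n => LinearMap.det A.linear)
      (frameMap_comp b T.toAffineMap y)
  have h2 : volume.real ((L.map T).1 : Set (Euc n)) =
      |LinearMap.det T.toAffineMap.linear| * volume.real (L.1 : Set (Euc n)) :=
    measure_affine_image T.toAffineMap _
  have h3 : |LinearMap.det T.toAffineMap.linear| ≠ 0 :=
    abs_ne_zero.2 (LinearEquiv.isUnit_det' T.linear).ne_zero
  rw [volumeRatio, h1, h2, abs_mul, mul_assoc, mul_div_mul_left _ _ h3, volumeRatio]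

theorem fit_map (L : SolidBody n) (T : Euc n ≃ᵃ[ℝ] Euc n) (y : ι → Euc n) :
    fit b K (L.map T) (fun i => T (y i)) = fit b K L y := by
  rw [fit, overlap_map, volumeRatio_map, fit]

theorem continuous_volumeRatio :
    Continuous fun q : SolidBody n × (ι → Euc n) => volumeRatio b K q.1 q.2 :=
  (((continuous_det_frameMap b).comp continuous_snd).abs.mul continuous_const).div
    (continuous_volume.comp continuous_fst) fun q => q.1.volume_pos.ne'

theorem continuous_frameMap_left (y : ι → Euc n) : Continuous (frameMap b y) :=
  AffineMap.continuous_of_finiteDimensional _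

theorem measurableSet_overlap (L : SolidBody n) (y : ι → Euc n) :
    MeasurableSet ((K.1 : Set (Euc n)) ∩ frameMap b y ⁻¹' (L.1 : Set (Euc n))) :=
  (K.1.isCompact.isClosed.inter
    (L.1.isCompact.isClosed.preimage (continuous_frameMap_left b y))).measurableSet

/-- A nonsingular map pulls the null frontier of `L` back to a null set, off which membership is
locally constant; dominated convergence then applies. -/
theorem continuousAt_overlap {L : SolidBody n} {y : ι → Euc n}
    (hy : LinearMap.det (frameMap b y).linear ≠ 0) :
    ContinuousAt (fun q : SolidBody n × (ι → Euc n) => overlap b K q.1 q.2) (L, y) := by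
  refine ContinuousAt.div_const ?_ _
  simp_rw [ContinuousAt, ← integral_indicator_one (measurableSet_overlap b K _ _)]
  refine tendsto_integral_filter_of_dominated_convergence
    ((K.1 : Set (Euc n)).indicator 1) ?_ ?_ ?_ ?_
  · exact .of_forall fun q =>
      (measurable_one.indicator (measurableSet_overlap b K _ _)).aestronglyMeasurable
  · refine .of_forall fun q => .of_forall fun z => ?_
    refine (Real.norm_of_nonneg (Set.indicator_nonneg (fun _ _ => zero_le_one) z)).trans_le ?_
    exact Set.indicator_le_indicator_of_subset Set.inter_subset_left (fun _ => zero_le_one) z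
  · exact (integrable_indicator_iff K.1.isCompact.isClosed.measurableSet).2
      (integrableOn_const K.1.isCompact.measure_lt_top.ne)
  · have hnull := affine_preimage_null hy (L.1.convex.addHaar_frontier volume)
    filter_upwards [measure_eq_zero_iff_ae_notMem.1 hnull] with z hz
    have hcont : Tendsto (fun q : SolidBody n × (ι → Euc n) => (q.1, frameMap b q.2 z))
        (𝓝 (L, y)) (𝓝 (L, frameMap b y z)) :=
      (continuous_fst.prodMk ((continuous_frameMap b z).comp continuous_snd)).continuousAt
    have hev : ∀ᶠ q : SolidBody n × (ι → Euc n) in 𝓝 (L, y),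
        (frameMap b q.2 z ∈ (q.1.1 : Set (Euc n)) ↔ frameMap b y z ∈ (L.1 : Set (Euc n))) := by
      by_cases h : frameMap b y z ∈ (L.1 : Set (Euc n))
      · have hint : frameMap b y z ∈ interior (L.1 : Set (Euc n)) := by
          by_contra h'
          exact hz ⟨subset_closure h, h'⟩
        filter_upwards [hcont.eventually (eventually_mem hint)] with q hq
        simp only [h, iff_true]
        exact hq
      · filter_upwards [hcont.eventually (eventually_notMem h)] with q hq
        simp only [h, iff_false]
        exact hq
    refine tendsto_const_nhds.congr' ?_
    filter_upwards [hev] with q hq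
    have h : z ∈ (K.1 : Set (Euc n)) ∩ frameMap b q.2 ⁻¹' (q.1.1 : Set (Euc n)) ↔
        z ∈ (K.1 : Set (Euc n)) ∩ frameMap b y ⁻¹' (L.1 : Set (Euc n)) := and_congr_right' hq
    by_cases h' : z ∈ (K.1 : Set (Euc n)) ∩ frameMap b y ⁻¹' (L.1 : Set (Euc n))
    · rw [Set.indicator_of_mem h', Set.indicator_of_mem (h.2 h')]
    · rw [Set.indicator_of_notMem h', Set.indicator_of_notMem (mt h.1 h')]

/-- At singular frames `overlap` may jump, but the factor `volumeRatio` tends to `0` there and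
squeezes the product. -/
theorem continuous_fit : Continuous fun q : SolidBody n × (ι → Euc n) => fit b K q.1 q.2 := by
  rw [continuous_iff_continuousAt]
  rintro ⟨L, y⟩
  by_cases hy : LinearMap.det (frameMap b y).linear = 0
  · have h0 : volumeRatio b K L y = 0 := by simp [volumeRatio, hy]
    have h1 : fit b K L y = 0 :=
      le_antisymm ((fit_le_volumeRatio b K L y).trans_eq h0) (fit_nonneg b K L y)
    have h2 := (continuous_volumeRatio b K).tendsto (L, y)
    rw [ContinuousAt]
    simp only [h0, h1] at h2 ⊢
    exact squeeze_zero (fun q => fit_nonneg b K q.1 q.2) (fun q => fit_le_volumeRatio b K q.1 q.2) h2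
  · exact (continuousAt_overlap b K hy).mul
      ((continuous_volumeRatio b K).continuousAt.min continuousAt_const)

/-- A closed subset of full volume of a convex body is the whole body. -/
theorem eq_of_isClosed_of_volume_le {C : Set (Euc n)} (hC : IsClosed C)
    (hsub : C ⊆ (K.1 : Set (Euc n)))
    (hvol : volume.real (K.1 : Set (Euc n)) ≤ volume.real C) : C = (K.1 : Set (Euc n)) := by
  refine hsub.antisymm fun x hx => ?_
  by_contra hxC
  have hcl : x ∈ closure (interior (K.1 : Set (Euc n))) := by
    rw [K.1.convex.closure_interior_eq_closure_of_nonempty_interior K.2]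
    exact subset_closure hx
  have hpos := ((hC.isOpen_compl.inter isOpen_interior).measure_pos volume
    (mem_closure_iff.1 hcl _ hC.isOpen_compl hxC))
  have hfin := K.1.isCompact.measure_lt_top (μ := volume)
  have hdiff : volume ((K.1 : Set (Euc n)) \ C) = 0 := by
    have h := measureReal_sdiff (μ := volume) hsub hC.measurableSet hfin.ne
    have h' : volume.real ((K.1 : Set (Euc n)) \ C) = 0 :=
      le_antisymm (by linarith) measureReal_nonneg
    exact (measureReal_eq_zero_iff
      (ne_top_of_le_ne_top hfin.ne (measure_mono Set.sdiff_subset))).1 h'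
  refine hpos.ne' (measure_mono_null ?_ hdiff)
  exact fun z hz => ⟨interior_subset hz.2, hz.1⟩

/-- Full overlap forces the image of `K` into `K`, and the volume ratio then forces the image to
fill `K`. -/
theorem frameMap_mem_affineSymmetries {y : ι → Euc n} (h : fit b K K y = 1) :
    frameMap b y ∈ affineSymmetries K := by
  have hm : 1 ≤ overlap b K K y := by
    rw [← h]
    exact mul_le_of_le_one_right (overlap_nonneg b K K y) (min_le_right _ _)
  have hr : 1 ≤ volumeRatio b K K y := by
    rw [← h]
    exact fit_le_volumeRatio b K K y
  rw [overlap, one_le_div K.volume_pos] at hm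
  rw [volumeRatio, one_le_div K.volume_pos] at hr
  have hsub := K.eq_of_isClosed_of_volume_le (K.1.isCompact.isClosed.inter
    (K.1.isCompact.isClosed.preimage (continuous_frameMap_left b y))) Set.inter_subset_left hm
  rw [← measure_affine_image] at hr
  refine K.eq_of_isClosed_of_volume_le
    (K.1.isCompact.image (continuous_frameMap_left b y)).isClosed ?_ hr
  rintro _ ⟨z, hz, rfl⟩
  rw [← hsub] at hz
  exact hz.2

end SolidBody

/-! ### Affine invariant points are exactly the points fixed by all symmetries. -/

namespace SolidBody

variable {n : ℕ}

/-- Interior basis points make `b` an interior point of the power of `K`, so that a continuous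
nonnegative weight positive at `b` has positive integral. -/
theorem exists_affineBasis_interior (K : SolidBody n) :
    ∃ (s : Set (Euc n)) (_ : Fintype s) (b : AffineBasis s ℝ (Euc n)),
      ∀ i, b i ∈ interior (K.1 : Set (Euc n)) := by
  obtain ⟨s, hs, b, hb⟩ :=
    AffineBasis.exists_affine_subbasis (isOpen_interior.affineSpan_eq_top K.2)
  have : Finite s := finite_of_fin_dim_affineIndependent ℝ b.ind
  exact ⟨s, Fintype.ofFinite s, b, fun i => by rw [hb]; exact hs i.2⟩

theorem affine_apply_smul_sub_add (T : Euc n →ᵃ[ℝ] Euc n) (c : ℝ) (x y z : Euc n) :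
    T (c • (x - y) + z) = c • (T x - T y) + T z := by
  have h : T (c • (x - y) +ᵥ z) = T.linear (c • (x - y)) +ᵥ T z := T.map_vadd _ _
  have h' : T.linear (x - y) = T x - T y := T.linearMap_vsub x y
  rw [vadd_eq_add, vadd_eq_add, map_smul, h'] at h
  exact h

variable {ι : Type*} [Fintype ι]

theorem continuous_fit_right (b : AffineBasis ι ℝ (Euc n)) (K L : SolidBody n) :
    Continuous fun y => fit b K L y := by
  have h : Continuous fun y : ι → Euc n => (L, y) := Continuous.prodMk_right L
  have h' := (continuous_fit b K).comp h
  simpa only [Function.comp_def] using h'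

/-- By compactness the fit attains its maximum over frames moving `x` by at least `ε`; the value `1`
would come from a symmetry, which fixes `x`. -/
theorem exists_fit_le (b : AffineBasis ι ℝ (Euc n)) (K : SolidBody n) {x : Euc n}
    (hx : x ∈ affineFixedPoints K) {ε : ℝ} (hε : 0 < ε) :
    ∃ a < 1, ∀ y ∈ K.power ι, ε ≤ ‖frameMap b y x - x‖ → fit b K K y ≤ a := by
  have hcont : Continuous fun y => fit b K K y := continuous_fit_right b K K
  have hcomp : IsCompact (K.power ι ∩ {y | ε ≤ ‖frameMap b y x - x‖}) :=
    K.isCompact_power.inter_right (isClosed_le continuous_const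
      ((continuous_frameMap b x).sub continuous_const).norm)
  rcases (K.power ι ∩ {y | ε ≤ ‖frameMap b y x - x‖}).eq_empty_or_nonempty with h | h
  · refine ⟨0, one_pos, fun y hy hy' => ?_⟩
    have : y ∈ (∅ : Set (ι → Euc n)) := h ▸ ⟨hy, hy'⟩
    exact this.elim
  · obtain ⟨y₀, hy₀, hmax⟩ := hcomp.exists_isMaxOn h hcont.continuousOn
    refine ⟨fit b K K y₀, (fit_le_one b K K y₀).lt_of_ne fun heq => ?_,
      fun y hy hy' => hmax ⟨hy, hy'⟩⟩
    have hfix := hx _ (frameMap_mem_affineSymmetries b K heq)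
    have := hy₀.2
    rw [Set.mem_ofPred_eq, hfix, sub_self, norm_zero] at this
    exact this.not_gt hε

theorem exists_isAffineInvariantPoint_near (K : SolidBody n) {x : Euc n}
    (hx : x ∈ affineFixedPoints K) {ε : ℝ} (hε : 0 < ε) :
    ∃ p : SolidBody n → Euc n, IsAffineInvariantPoint p ∧ ‖p K - x‖ ≤ ε := by
  obtain ⟨s, _, b, hb⟩ := K.exists_affineBasis_interior
  obtain ⟨a, ha, hfit⟩ := exists_fit_le b K hx hε
  -- The cutoff at `a` gives zero weight to frames in `K` moving `x` by `ε` or more.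
  set w : SolidBody n → (s → Euc n) → ℝ := fun L y => max 0 (fit b K L y - a) with hw
  have hwc : Continuous fun q : SolidBody n × (s → Euc n) => w q.1 q.2 :=
    continuous_const.max ((continuous_fit b K).sub continuous_const)
  have hwK : Continuous (w K) :=
    continuous_const.max ((continuous_fit_right b K K).sub continuous_const)
  have hw0 : ∀ L y, 0 ≤ w L y := fun L y => le_max_left _ _
  have hint {F : Type} [NormedAddCommGroup F] {g : (s → Euc n) → F} (hg : Continuous g) :
      IntegrableOn g (K.power s) := hg.continuousOn.integrableOn_compact K.isCompact_power
  have hV := K.volume_power_pos (ι := s)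
  have hI : 0 < ∫ y in K.power s, w K y := by
    rw [setIntegral_pos_iff_support_of_nonneg_ae (.of_forall fun y => hw0 K y) (hint hwK)]
    refine (((isOpen_Ioi (a := (0 : ℝ))).preimage hwK |>.inter
      (isOpen_interior (s := K.power s))).measure_pos volume ⟨b, ?_, ?_⟩).trans_le
      (measure_mono fun y hy => ⟨(Set.mem_Ioi.1 hy.1).ne', interior_subset hy.2⟩)
    · change 0 < w K b
      rw [hw]
      simp only [fit_basis]
      exact lt_max_of_lt_right (sub_pos.2 ha)
    · rw [interior_power]
      exact fun i _ => hb i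
  set V := volume.real (K.power s)
  set I := ∫ y in K.power s, w K y
  -- The normalizing constant is that of `K` for every `L`, since the total weight at another `L`
  -- may vanish. The centroid below absorbs the missing or excess mass and keeps the average
  -- equivariant.
  set v : SolidBody n → (s → Euc n) → ℝ := fun L y => w L y * (V / I) with hv
  have hvc : Continuous fun q : SolidBody n × (s → Euc n) => v q.1 q.2 :=
    hwc.mul continuous_const
  have hvK : Continuous (v K) := hwK.mul continuous_const
  have hv0 : ∀ y, 0 ≤ v K y := fun y => mul_nonneg (hw0 K y) (div_pos hV hI).le
  have hvint : ∫ y in K.power s, v K y = V := by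
    rw [hv]
    simp only [integral_mul_const]
    exact mul_div_cancel₀ V hI.ne'
  refine ⟨fun L => ⨍ y in L.power s,
    (centroid L + v L y • (frameMap b y x - centroid L)),
    isAffineInvariantPoint_setAverage (f := fun L y =>
      centroid L + v L y • (frameMap b y x - centroid L)) ?_ ?_, ?_⟩
  · have hc : Continuous fun q : SolidBody n × (s → Euc n) => centroid q.1 :=
      isAffineInvariantPoint_centroid.1.comp continuous_fst
    exact hc.add (hvc.smul (((continuous_frameMap b x).comp continuous_snd).sub hc))
  · intro T L y
    have h1 : frameMap b (fun i => T (y i)) x = T (frameMap b y x) :=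
      congrArg (· x) (frameMap_comp b T.toAffineMap y)
    have h2 : v (L.map T) (fun i => T (y i)) = v L y := by
      change max 0 (fit b K (L.map T) (fun i => T (y i)) - a) * _ = _
      rw [fit_map]
    beta_reduce
    rw [h1, h2, isAffineInvariantPoint_centroid.2, add_comm, add_comm (centroid L)]
    exact (affine_apply_smul_sub_add T.toAffineMap _ _ _ _).symm
  · beta_reduce
    set c := centroid K
    -- Since `v K` has average `1`, the middle term integrates to zero and only the displacements of
    -- `x` remain.
    have hdecomp : ∀ y, c + v K y • (frameMap b y x - c) =
        (x + (1 - v K y) • (c - x)) + v K y • (frameMap b y x - x) := fun y => by module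
    simp only [hdecomp]
    rw [setAverage_eq]
    have hg : Continuous fun y => v K y • (frameMap b y x - x) :=
      hvK.smul ((continuous_frameMap b x).sub continuous_const)
    have h1v : Continuous fun y => (1 - v K y) • (c - x) :=
      (continuous_const.sub hvK).smul continuous_const
    have h2v : ∫ y in K.power s, (1 - v K y) • (c - x) = 0 := by
      rw [integral_smul_const, integral_sub (hint continuous_const) (hint hvK), hvint,
        setIntegral_const, smul_eq_mul, mul_one, sub_self, zero_smul]
    have hx1 : Continuous fun _ : s → Euc n => x := continuous_const
    have h3v : Continuous fun y => x + (1 - v K y) • (c - x) := hx1.add h1v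
    rw [integral_add (hint h3v) (hint hg), integral_add (hint hx1) (hint h1v), h2v,
      setIntegral_const, add_zero]
    change ‖V⁻¹ • (V • x + _) - x‖ ≤ ε
    rw [smul_add, smul_smul, inv_mul_cancel₀ hV.ne', one_smul, add_sub_cancel_left, norm_smul,
      norm_inv, Real.norm_of_nonneg hV.le, inv_mul_le_iff₀ hV]
    calc ‖∫ y in K.power s, v K y • (frameMap b y x - x)‖
        ≤ ∫ y in K.power s, v K y * ε := by
          refine norm_integral_le_of_norm_le (hint (hvK.mul continuous_const)) ?_
          filter_upwards [ae_restrict_mem K.measurableSet_power] with y hy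
          rw [norm_smul, Real.norm_of_nonneg (hv0 y)]
          by_cases h : ε ≤ ‖frameMap b y x - x‖
          · have : v K y = 0 := by
              have h0 : w K y = 0 := max_eq_left (sub_nonpos.2 (hfit y hy h))
              change w K y * (V / I) = 0
              rw [h0, zero_mul]
            rw [this, zero_mul, zero_mul]
          · exact mul_le_mul_of_nonneg_left (not_le.1 h).le (hv0 y)
      _ = V * ε := by rw [integral_mul_const, hvint]

/-- The affine subspace of the values at `K` of the affine invariant points. -/
def invariantSubspace (K : SolidBody n) : AffineSubspace ℝ (Euc n) where
  carrier := affineInvariantPoints K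
  smul_vsub_vadd_mem' := by
    rintro c _ _ _ ⟨p, hp, rfl⟩ ⟨q, hq, rfl⟩ ⟨r, hr, rfl⟩
    refine ⟨fun L => c • (p L - q L) + r L,
      ⟨((hp.1.sub hq.1).const_smul c).add hr.1, fun T L => ?_⟩, rfl⟩
    beta_reduce
    rw [hp.2, hq.2, hr.2]
    exact (affine_apply_smul_sub_add T.toAffineMap _ _ _ _).symm

theorem affineFixedPoints_subset (K : SolidBody n) :
    affineFixedPoints K ⊆ affineInvariantPoints K := by
  intro x hx
  have hclosed : IsClosed (K.invariantSubspace : Set (Euc n)) :=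
    AffineSubspace.closed_of_finiteDimensional _
  change x ∈ (K.invariantSubspace : Set (Euc n))
  rw [← hclosed.closure_eq, Metric.mem_closure_iff]
  intro ε hε
  obtain ⟨p, hp, hpx⟩ := K.exists_isAffineInvariantPoint_near hx (half_pos hε)
  refine ⟨p K, ⟨p, hp, rfl⟩, ?_⟩
  rw [dist_comm, dist_eq_norm]
  linarith

theorem abs_det_eq_one {K : SolidBody n} {T : Euc n →ᵃ[ℝ] Euc n}
    (hT : T ∈ affineSymmetries K) : |LinearMap.det T.linear| = 1 := by
  have h := measure_affine_image T (K.1 : Set (Euc n))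
  rw [show T '' (K.1 : Set (Euc n)) = (K.1 : Set (Euc n)) from hT] at h
  exact (mul_eq_right₀ K.volume_pos.ne').1 h.symm

theorem affineInvariantPoints_subset (K : SolidBody n) :
    affineInvariantPoints K ⊆ affineFixedPoints K := by
  rintro _ ⟨p, hp, rfl⟩ T hT
  have hdet : LinearMap.det T.linear ≠ 0 := fun h => by
    simpa [h] using abs_det_eq_one hT
  have hbij : Function.Bijective T := T.linear_bijective_iff.1
    (LinearEquiv.ofIsUnitDet (f := T.linear)
      (v := Module.finBasis ℝ (Euc n)) (v' := Module.finBasis ℝ (Euc n))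
      (by rw [LinearMap.det_toMatrix]; exact hdet.isUnit)).bijective
  have h := hp.2 (AffineEquiv.ofBijective hbij) K
  rw [map_eq_self (by exact hT)] at h
  exact h.symm

theorem affineInvariantPoints_eq (K : SolidBody n) :
    affineInvariantPoints K = affineFixedPoints K :=
  K.affineInvariantPoints_subset.antisymm K.affineFixedPoints_subset

end SolidBody

/-! ### Symmetries fixing a hyperplane pointwise. -/

theorem Submodule.exists_ker_eq_of_finrank_add_one {V : Type*} [AddCommGroup V] [Module ℝ V]
    [FiniteDimensional ℝ V] {W : Submodule ℝ V}
    (h : Module.finrank ℝ W + 1 = Module.finrank ℝ V) :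
    ∃ φ : V →ₗ[ℝ] ℝ, LinearMap.ker φ = W := by
  obtain ⟨φ, hφ, hle⟩ := W.exists_le_ker_of_lt_top (lt_top_iff_ne_top.2 fun hW => by
    rw [hW, finrank_top] at h
    omega)
  refine ⟨φ, (Submodule.eq_of_le_of_finrank_le hle ?_).symm⟩
  have := Submodule.finrank_lt (mt LinearMap.ker_eq_top.1 hφ)
  omega

namespace SolidBody

variable {n : ℕ} {K : SolidBody n}

theorem exists_mem_apply_ne_zero (K : SolidBody n) {φ : Euc n →ₗ[ℝ] ℝ} (hφ : φ ≠ 0)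
    (h : Euc n) : ∃ x ∈ (K.1 : Set (Euc n)), φ (x - h) ≠ 0 := by
  by_contra! H
  refine hφ (LinearMap.ext fun v => ?_)
  obtain ⟨x, hx⟩ := K.2
  have hev : ∀ᶠ t : ℝ in 𝓝 0, x + t • v ∈ (K.1 : Set (Euc n)) := by
    have hc : ContinuousAt (fun t : ℝ => x + t • v) 0 := by fun_prop
    refine hc.eventually_mem ?_
    rw [zero_smul, add_zero]
    exact mem_interior_iff_mem_nhds.1 hx
  obtain ⟨t, ht, ht0⟩ := ((hev.filter_mono nhdsWithin_le_nhds).and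
    (self_mem_nhdsWithin (s := Set.Ioi (0 : ℝ)))).exists
  have h1 := H _ ht
  rw [add_sub_right_comm, map_add, H x (interior_subset hx), zero_add, map_smul,
    smul_eq_mul] at h1
  exact (mul_eq_zero.1 h1).resolve_left (ne_of_gt ht0)

/-- A symmetry of a convex body is not a nontrivial shear. -/
theorem shear_eq_zero {T : Euc n →ᵃ[ℝ] Euc n} (hT : T ∈ affineSymmetries K)
    {φ : Euc n →ₗ[ℝ] ℝ} (hφ : φ ≠ 0) {h η : Euc n} (hTx : ∀ x, T x = x + φ (x - h) • η)
    (hη : φ η = 0) : η = 0 := by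
  obtain ⟨x, hx, hx0⟩ := K.exists_mem_apply_ne_zero hφ h
  -- As `φ η = 0`, each step of `T` adds the same vector, so the orbit of `x` is unbounded unless `η
  -- = 0`.
  have hiter : ∀ k : ℕ, T^[k] x = x + (k * φ (x - h)) • η := by
    intro k
    induction k with
    | zero => simp
    | succ k ih =>
      rw [Function.iterate_succ_apply', ih, hTx, add_sub_right_comm, map_add, map_smul, hη]
      push_cast
      module
  have hmaps : Set.MapsTo T (K.1 : Set (Euc n)) (K.1 : Set (Euc n)) :=
    Set.mapsTo_iff_image_subset.2 (Eq.subset hT)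
  obtain ⟨R, hR⟩ := K.1.isCompact.isBounded.exists_norm_le
  by_contra hne
  have hpos : 0 < |φ (x - h)| * ‖η‖ := mul_pos (abs_pos.2 hx0) (norm_pos_iff.2 hne)
  obtain ⟨k, hk⟩ := exists_nat_gt ((R + ‖x‖) / (|φ (x - h)| * ‖η‖))
  rw [div_lt_iff₀ hpos] at hk
  have h1 := hR _ (hmaps.iterate k hx)
  rw [hiter] at h1
  have h2 : ‖((k : ℝ) * φ (x - h)) • η‖ ≤ ‖x + ((k : ℝ) * φ (x - h)) • η‖ + ‖x‖ := by
    simpa using norm_sub_le (x + ((k : ℝ) * φ (x - h)) • η) x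
  rw [norm_smul, norm_mul, Real.norm_natCast, Real.norm_eq_abs, mul_assoc] at h2
  linarith

/-- A symmetry of a convex body fixing a hyperplane pointwise is the identity or a reflection. -/
theorem exists_eq_add_smul {T : Euc n →ᵃ[ℝ] Euc n} (hT : T ∈ affineSymmetries K)
    {φ : Euc n →ₗ[ℝ] ℝ} (hφ : φ ≠ 0) {h : Euc n} (hfix : ∀ v, φ v = 0 → T (h + v) = h + v) :
    ∃ η, (η = 0 ∨ φ η = -2) ∧ ∀ x, T x = x + φ (x - h) • η := by
  have hlin : ∀ v, T (h + v) = T.linear v + h := fun v => by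
    have h1 : T (v +ᵥ h) = T.linear v +ᵥ T h := T.map_vadd h v
    have h2 := hfix 0 (map_zero φ)
    rw [add_zero] at h2
    rwa [h2, vadd_eq_add, vadd_eq_add, add_comm v] at h1
  obtain ⟨u, hu⟩ : ∃ u, φ u ≠ 0 := by
    by_contra! H
    exact hφ (LinearMap.ext H)
  set e := (φ u)⁻¹ • u with he
  have he1 : φ e = 1 := by rw [he, map_smul, smul_eq_mul, inv_mul_cancel₀ hu]
  set η := T.linear e - e with hη
  -- `T.linear` fixes `ker φ`, and `v - φ v • e` lies there, so `T.linear` is determined by its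
  -- value at `e`.
  have htrans : T.linear = LinearMap.transvection φ η := by
    ext1 v
    have h1 := hfix (v - φ v • e) (by rw [map_sub, map_smul, he1]; simp)
    rw [hlin, map_sub, map_smul, add_comm h, add_left_inj] at h1
    rw [LinearMap.transvection.apply, hη, smul_sub, sub_eq_iff_eq_add.1 h1]
    abel
  have hTx : ∀ x, T x = x + φ (x - h) • η := fun x => by
    have h1 := hlin (x - h)
    rw [add_sub_cancel, htrans, LinearMap.transvection.apply] at h1
    rw [h1]
    abel
  refine ⟨η, ?_, hTx⟩
  have hdet := abs_det_eq_one hT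
  rw [htrans, LinearMap.transvection.det] at hdet
  -- The determinant is `1 + φ η`, so `φ η` is `0` or `-2`.
  rcases (abs_eq zero_le_one).1 hdet with h1 | h1
  · exact .inl (shear_eq_zero hT hφ hTx (by linarith))
  · exact .inr (by linarith)

theorem comp_mem_affineSymmetries {S T : Euc n →ᵃ[ℝ] Euc n} (hS : S ∈ affineSymmetries K)
    (hT : T ∈ affineSymmetries K) : S.comp T ∈ affineSymmetries K := by
  change S.comp T '' _ = _
  rw [AffineMap.coe_comp, Set.image_comp, show T '' _ = _ from hT]
  exact hS

end SolidBody

/-! ### The symmetry group when `𝔓(K)` spans a hyperplane. -/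

theorem theorem2 (n : ℕ) (K : SolidBody n)
    (hdim : Module.finrank ℝ (vectorSpan ℝ (affineInvariantPoints K)) + 1 = n) :
    affineInvariantPoints K = affineFixedPoints K ∧
    ∃ (H : AffineSubspace ℝ (Euc n)) (S : Euc n →ᵃ[ℝ] Euc n),
      (H : Set (Euc n)) = affineInvariantPoints K ∧
      IsAffineReflection S H ∧
      affineSymmetries K = {AffineMap.id ℝ (Euc n), S} := by
  refine ⟨K.affineInvariantPoints_eq, ?_⟩
  set H := K.invariantSubspace
  have hHc : (H : Set (Euc n)) = affineInvariantPoints K := rfl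
  have hHdir : Module.finrank ℝ H.direction + 1 = n := by
    rw [AffineSubspace.direction, hHc]
    exact hdim
  have hc : K.centroid ∈ H := ⟨_, SolidBody.isAffineInvariantPoint_centroid, rfl⟩
  set c := K.centroid
  obtain ⟨φ, hφ⟩ := Submodule.exists_ker_eq_of_finrank_add_one (W := H.direction)
    (by rw [hHdir, finrank_euclideanSpace_fin])
  have hφ0 : φ ≠ 0 := by
    rintro rfl
    rw [← hφ, LinearMap.ker_zero, finrank_top, finrank_euclideanSpace_fin] at hHdir
    omega
  have hker : ∀ v, φ v = 0 → c + v ∈ H := fun v hv => by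
    rw [add_comm]
    exact AffineSubspace.vadd_mem_of_mem_direction (hφ ▸ LinearMap.mem_ker.2 hv) hc
  have hform : ∀ T ∈ affineSymmetries K,
      ∃ η, (η = 0 ∨ φ η = -2) ∧ ∀ x, T x = x + φ (x - c) • η := fun T hT =>
    SolidBody.exists_eq_add_smul hT hφ0 fun v hv =>
      K.affineInvariantPoints_subset (hker v hv) T hT
  have hid : AffineMap.id ℝ (Euc n) ∈ affineSymmetries K := Set.image_id _
  obtain ⟨S, hS, hSid⟩ : ∃ S ∈ affineSymmetries K, S ≠ AffineMap.id ℝ (Euc n) := by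
    by_contra! hall
    have htop : H = ⊤ := by
      refine (AffineSubspace.coe_eq_univ_iff _).1 (Set.eq_univ_of_forall fun x => ?_)
      refine K.affineFixedPoints_subset fun T hT => ?_
      rw [hall T hT, AffineMap.id_apply]
    rw [htop, AffineSubspace.direction_top, finrank_top, finrank_euclideanSpace_fin] at hHdir
    omega
  obtain ⟨ξ, hξ, hSx⟩ := hform S hS
  have hid_of {T : Euc n →ᵃ[ℝ] Euc n} {η : Euc n} (hTx : ∀ x, T x = x + φ (x - c) • η)
      (hη : η = 0) : T = AffineMap.id ℝ (Euc n) := by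
    ext1 x
    rw [hTx, hη, smul_zero, add_zero, AffineMap.id_apply]
  have hξ2 : φ ξ = -2 := hξ.resolve_left fun h => hSid (hid_of hSx h)
  refine ⟨H, S, hHc, ⟨⟨c, hc⟩, hHdir, ξ, ?_, ?_⟩, ?_⟩
  · rw [← hφ, LinearMap.mem_ker, hξ2]
    norm_num
  · intro h hh t
    have h0 : φ (h - c) = 0 := by
      rw [← LinearMap.mem_ker, hφ]
      exact AffineSubspace.vsub_mem_direction hh hc
    rw [hSx, add_sub_right_comm, map_add, h0, map_smul, hξ2, smul_eq_mul]
    module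
  · refine Set.Subset.antisymm (fun T hT => ?_) ?_
    · obtain ⟨η, hη, hTx⟩ := hform T hT
      rcases hη with hη | hη
      · exact .inl (hid_of hTx hη)
      -- The composite of the two reflections has vector `ζ = η - ξ`, and `φ ζ = 0` excludes the
      -- reflection case, so `ζ = 0`.
      obtain ⟨ζ, hζ, hζx⟩ := hform _ (SolidBody.comp_mem_affineSymmetries hS hT)
      have hdiff : ∀ x, φ (x - c) • ζ = φ (x - c) • (η - ξ) := fun x => by
        have h1 := hζx x
        rw [AffineMap.comp_apply, hTx, hSx, add_sub_right_comm, map_add, map_smul, hη] at h1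
        have h2 : φ (x - c) • ζ =
            x + φ (x - c) • η + (φ (x - c) + φ (x - c) • (-2)) • ξ - x := by
          rw [h1]; abel
        rw [h2, smul_eq_mul]
        module
      obtain ⟨x, -, hx⟩ := K.exists_mem_apply_ne_zero hφ0 c
      have hζ' := smul_right_injective _ hx (hdiff x)
      have hζ0 : ζ = 0 := hζ.resolve_right fun h => by
        rw [hζ', map_sub, hη, hξ2] at h
        norm_num at h
      right
      rw [Set.mem_singleton_iff]
      ext1 y
      rw [hTx, hSx, sub_eq_zero.1 (hζ'.symm.trans hζ0)]
    · rintro T (rfl | rfl)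
      · exact hid
      · exact hS
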